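/- Let $H^2$ be the hyperbolic plane with distance $d$, and let $K\subset H^2$ be a convex body (a compact, geodesically convex set with non-empty interior) of diameter $D$. A supporting line to $K$ at $z\in\partial K$ is a geodesic line through $z$ such that $K$ lies in one of the two closed half-planes it bounds; a unit vector $v\in T_zH^2$ is an outer normal to $K$ at $z$ if it is orthogonal to such a line and points out of that half-plane. $K$ is *of constant width* if there is a $w>0$ such that for every $x\in\partial K$ and every outer unit normal vector $v\in T_xH^2$ to $K$ at $x$ there is a $y\in\partial K$ such that the geodesic segment $[x,y]$ is contained in $K$, has length $w$, and $-v$ points along $[x,y]$. Let $z\in\partial K$ and let $\ell_z$ be a supporting line to $K$ at $z$. A point $z'\in\partial K$, $z'\neq z$, is *opposite to $z$ with respect to $\ell_z$* if there is a supporting line $\ell_{z'}$ to $K$ at $z'$ such that $\ell_z$ and $\ell_{z'}$ have equal alternating angles with the segment $[z,z']$; that is, there are a ray of $\ell_z$ from $z$ and a ray of $\ell_{z'}$ from $z'$ that lie on opposite (open) sides of the line $zz'$ and form equal angles with $[z,z']$. The line $\ell_{z'}$ is then unique, and the *Jerónimo-Castro–Jimenez-Lopez width* of $K$ at $(z,\ell_z,z')$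 is $$w_{JCJL}(K,(z,\ell_z,z'))=d(\ell_z,\ell_{z'})=\inf\{d(p,q)\colon p\in\ell_z,\ q\in\ell_{z'}\}.$$ Then $K$ is of constant width if and only if $w_{JCJL}(K,(z,\ell_z,z'))=D$ for all $z\in\partial K$, all supporting lines $\ell_z$ to $K$ at $z$, and all points $z'$ opposite to $z$ with respect to $\ell_z$. -/

import Mathlib

namespace HypPlane

/-! ### The hyperboloid model of the hyperbolic plane -/

/-- The Lorentzian symmetric bilinear form on `ℝ³`; the coordinate `0` is the time coordinate. -/
def lor (x y : Fin 3 → ℝ) : ℝ := x 0 * y 0 - x 1 * y 1 - x 2 * y 2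

/-- The hyperbolic plane `H²`: the upper sheet of the hyperboloid, with the subspace topology. -/
abbrev H2 : Type := {x : Fin 3 → ℝ // lor x x = 1 ∧ 1 ≤ x 0}

/-- Hyperbolic distance, `cosh d(x, y) = B(x, y)`. -/
noncomputable def hdist (x y : H2) : ℝ := Real.arcosh (lor x.1 y.1)

/-- `u` is a unit vector of the tangent plane `T_z` (whose scalar product is `-B`). -/
def IsUnitTangent (z : H2) (u : Fin 3 → ℝ) : Prop := lor u z.1 = 0 ∧ lor u u = -1

/-- The point with parameter `t` of the unit speed geodesic starting from `z` in direction `u`. -/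
noncomputable def geod (z : H2) (u : Fin 3 → ℝ) (t : ℝ) : Fin 3 → ℝ :=
  Real.cosh t • z.1 + Real.sinh t • u

/-- The geodesic line through `z` determined by the unit tangent vector `u`. -/
def geodLine (z : H2) (u : Fin 3 → ℝ) : Set H2 := {p | ∃ t : ℝ, p.1 = geod z u t}

/-- The geodesic segment `[x, y]`. -/
def seg (x y : H2) : Set H2 :=
  {p | ∃ (u : Fin 3 → ℝ) (s t : ℝ), IsUnitTangent x u ∧ 0 ≤ s ∧ s ≤ t ∧
    y.1 = geod x u t ∧ p.1 = geod x u s}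

/-- The unit tangent vector `e` at `x` points towards `y` along a segment of positive length. -/
def PointsTowards (x : H2) (e : Fin 3 → ℝ) (y : H2) : Prop :=
  IsUnitTangent x e ∧ ∃ t : ℝ, 0 < t ∧ y.1 = geod x e t

/-- The angle of two unit vectors of the same tangent plane. -/
noncomputable def tangentAngle (u v : Fin 3 → ℝ) : ℝ := Real.arccos (-lor u v)

/-- The distance of two sets (used for lines). -/
noncomputable def setDist (A B : Set H2) : ℝ := sInf {r | ∃ p ∈ A, ∃ q ∈ B, r = hdist p q}

/-- The diameter of a set. -/
noncomputable def hdiam (K : Set H2) : ℝ := sSup {r | ∃ x ∈ K, ∃ y ∈ K, r = hdist x y}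

/-! ### Convex bodies and constant width -/

/-- A convex body: compact, geodesically convex, with non-empty interior. -/
def IsConvexBody (K : Set H2) : Prop :=
  IsCompact K ∧ (∀ x ∈ K, ∀ y ∈ K, seg x y ⊆ K) ∧ (interior K).Nonempty

/-- `v` is an outer unit normal vector to `K` at `z`: `K` lies in the half-plane bounded by the
line orthogonal to `v` at `z` on the side away from `v`. -/
def IsOuterNormal (K : Set H2) (z : H2) (v : Fin 3 → ℝ) : Prop :=
  IsUnitTangent z v ∧ ∀ x ∈ K, 0 ≤ lor x.1 v

/-- `ℓ` is a supporting line to `K` at `z`: it is the line through `z` orthogonal to an outer unit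
normal vector to `K` at `z`. -/
def IsSupportingLine (K : Set H2) (z : H2) (ℓ : Set H2) : Prop :=
  ∃ v, IsOuterNormal K z v ∧ ℓ = {x : H2 | lor x.1 v = 0}

/-- `K` is of constant width `w`: from every boundary point, in the direction opposite to any outer
unit normal vector, starts a chord of `K` of length `w` that ends on the boundary. -/
def IsOfConstantWidth (K : Set H2) (w : ℝ) : Prop :=
  0 < w ∧ ∀ x ∈ frontier K, ∀ v, IsOuterNormal K x v →
    ∃ y ∈ frontier K, seg x y ⊆ K ∧ y.1 = geod x (-v) w

/-- `K` is of constant width. -/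
def HasConstantWidth (K : Set H2) : Prop := ∃ w, IsOfConstantWidth K w

/-! ### The Jerónimo-Castro–Jimenez-Lopez width -/

/-- The lines `ℓ` through `z` and `ℓ'` through `z'` have equal alternating angles with the segment
`[z, z']`: there are unit direction vectors `u` of `ℓ` at `z` and `u'` of `ℓ'` at `z'`, pointing
into opposite open sides of the line `zz'` (with unit normal `n`), that form equal angles with the
segment at `z` and at `z'`. -/
def EqualAlternatingAngles (z : H2) (ℓ : Set H2) (z' : H2) (ℓ' : Set H2) : Prop :=
  ∃ e e' n u u' : Fin 3 → ℝ,
    PointsTowards z e z' ∧ PointsTowards z' e' z ∧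
    IsUnitTangent z n ∧ IsUnitTangent z' n ∧
    IsUnitTangent z u ∧ ℓ = geodLine z u ∧
    IsUnitTangent z' u' ∧ ℓ' = geodLine z' u' ∧
    lor u n * lor u' n < 0 ∧
    tangentAngle u e = tangentAngle u' e'

/-- `ℓ'` is a supporting line at the boundary point `z'` that witnesses that `z'` is opposite to `z`
with respect to `ℓ`. -/
def IsOppositeLine (K : Set H2) (z : H2) (ℓ : Set H2) (z' : H2) (ℓ' : Set H2) : Prop :=
  IsSupportingLine K z' ℓ' ∧ EqualAlternatingAngles z ℓ z' ℓ'

/-- `z'` is an opposite point to `z` with respect to the supporting line `ℓ`. -/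
def IsOppositePoint (K : Set H2) (z : H2) (ℓ : Set H2) (z' : H2) : Prop :=
  z' ∈ frontier K ∧ ∃ ℓ', IsOppositeLine K z ℓ z' ℓ'

/-- The Jerónimo-Castro–Jimenez-Lopez width of `K` at `(z, ℓ, z')`: the distance of `ℓ` and the
supporting line `ℓ'` at `z'`. The choice of `ℓ'` is immaterial, see `jcjlWidth_eq`. -/
noncomputable def jcjlWidth (K : Set H2) (z : H2) (ℓ : Set H2) (z' : H2)
    (h : IsOppositePoint K z ℓ z') : ℝ :=
  setDist ℓ h.2.choose

/-! ### The witnessing line is unique, so that the width is well defined -/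

theorem geod_mem (z : H2) (u : Fin 3 → ℝ) (hu : IsUnitTangent z u) (t : ℝ) :
    lor (geod z u t) (geod z u t) = 1 ∧ 1 ≤ geod z u t 0 := by
  have hz := z.2.1
  have hz0 := z.2.2
  obtain ⟨h1, h2⟩ := hu
  have hcs := Real.cosh_sq t
  have key : lor (geod z u t) (geod z u t) = 1 := by
    simp only [lor, geod, Pi.add_apply, Pi.smul_apply, smul_eq_mul] at *
    linear_combination (Real.cosh t) ^ 2 * hz + (Real.sinh t) ^ 2 * h2 +
      2 * Real.cosh t * Real.sinh t * h1 + hcs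
  refine ⟨key, ?_⟩
  have hpos : 0 < geod z u t 0 := by
    simp only [lor, geod, Pi.add_apply, Pi.smul_apply, smul_eq_mul] at *
    have hu0 : (u 0) ^ 2 < (z.1 0) ^ 2 := by
      have hS : (z.1 1 * u 2 - z.1 2 * u 1) ^ 2 = (z.1 0) ^ 2 - (u 0) ^ 2 - 1 := by
        linear_combination (z.1 0 * u 0 + (z.1 1 * u 1 + z.1 2 * u 2)) * h1 -
          (z.1 1 ^ 2 + z.1 2 ^ 2) * h2 - (u 0 ^ 2 + 1) * hz
      nlinarith [sq_nonneg (z.1 1 * u 2 - z.1 2 * u 1)]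
    have hab : |u 0| < z.1 0 := by
      have := sq_lt_sq.1 hu0
      rwa [abs_of_pos (by linarith : (0 : ℝ) < z.1 0)] at this
    have hs : |Real.sinh t| < Real.cosh t := by
      have : Real.sinh t ^ 2 < Real.cosh t ^ 2 := by linarith
      have := sq_lt_sq.1 this
      rwa [abs_of_pos (Real.cosh_pos t)] at this
    have h3 : |Real.sinh t * u 0| < Real.cosh t * z.1 0 := by
      rw [abs_mul]
      exact mul_lt_mul'' hs hab (abs_nonneg _) (abs_nonneg _)
    linarith [neg_abs_le (Real.sinh t * u 0)]
  simp only [lor] at key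
  nlinarith [sq_nonneg (geod z u t 1), sq_nonneg (geod z u t 2)]

theorem lor_geod (z : H2) (u : Fin 3 → ℝ) (hu : IsUnitTangent z u) (t : ℝ) :
    lor (geod z u t) z.1 = Real.cosh t := by
  have hz := z.2.1
  have h1 := hu.1
  simp only [lor, geod, Pi.add_apply, Pi.smul_apply, smul_eq_mul] at *
  linear_combination Real.cosh t * hz + Real.sinh t * h1

theorem geod_inj {z : H2} {u v : Fin 3 → ℝ} {t : ℝ} (ht : t ≠ 0)
    (h : geod z u t = geod z v t) : u = v := by
  have h' : Real.sinh t • u = Real.sinh t • v := by simpa [geod] using h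
  exact smul_right_injective _ (by simpa using ht : Real.sinh t ≠ 0) h'

theorem pointsTowards_unique {x y : H2} {e f : Fin 3 → ℝ} (he : PointsTowards x e y)
    (hf : PointsTowards x f y) : e = f := by
  obtain ⟨he, t, ht, h1⟩ := he
  obtain ⟨hf, s, hs, h2⟩ := hf
  have h3 := lor_geod x e he t
  rw [← h1, h2, lor_geod x f hf s] at h3
  have : s = t := by
    exact Real.cosh_injOn (Set.mem_Ici.2 hs.le) (Set.mem_Ici.2 ht.le) h3
  subst this
  exact geod_inj ht.ne' (h1.symm.trans h2)

theorem geodLine_dir {z : H2} {u v : Fin 3 → ℝ} (hu : IsUnitTangent z u) (hv : IsUnitTangent z v)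
    (h : geodLine z u = geodLine z v) : v = u ∨ v = -u := by
  have hm : (⟨geod z u 1, geod_mem z u hu 1⟩ : H2) ∈ geodLine z v := h ▸ ⟨1, rfl⟩
  obtain ⟨s, hs⟩ := hm
  simp only at hs
  have h3 := lor_geod z u hu 1
  rw [hs, lor_geod z v hv s, ← Real.cosh_abs s] at h3
  have h4 : |s| = 1 :=
    Real.cosh_injOn (Set.mem_Ici.2 (abs_nonneg s)) (Set.mem_Ici.2 zero_le_one) h3
  rcases (abs_eq zero_le_one).1 h4 with rfl | rfl
  · exact Or.inl (geod_inj one_ne_zero hs).symm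
  · right
    have : geod z v (-1) = geod z (-v) 1 := by simp [geod]
    rw [this] at hs
    rw [geod_inj one_ne_zero hs, neg_neg]

theorem geodLine_neg (z : H2) (u : Fin 3 → ℝ) : geodLine z (-u) = geodLine z u := by
  ext p
  constructor <;> rintro ⟨t, ht⟩ <;> exact ⟨-t, by simpa [geod] using ht⟩

/-- Expansion of a tangent vector in an orthonormal basis of the tangent plane. -/
theorem tangent_expand {z : H2} {e n u : Fin 3 → ℝ} (he : IsUnitTangent z e)
    (hn : IsUnitTangent z n) (hen : lor n e = 0) (hu : lor u z.1 = 0) :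
    u = -(lor u e) • e + -(lor u n) • n := by
  have hz := z.2.1
  obtain ⟨he1, he2⟩ := he
  obtain ⟨hn1, hn2⟩ := hn
  let A : Matrix (Fin 3) (Fin 3) ℝ := !![z.1 0, z.1 1, z.1 2; e 0, e 1, e 2; n 0, n 1, n 2]
  let B : Matrix (Fin 3) (Fin 3) ℝ :=
    !![z.1 0, -e 0, -n 0; -z.1 1, e 1, n 1; -z.1 2, e 2, n 2]
  have hAB : A * B = 1 := by
    simp only [lor] at *
    ext i j
    fin_cases i <;> fin_cases j <;> simp [A, B, Matrix.mul_apply, Fin.sum_univ_three] <;> linarith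
  have hBA : B * A = 1 := mul_eq_one_comm.1 hAB
  have hent : ∀ i j, (B * A) i j = (1 : Matrix (Fin 3) (Fin 3) ℝ) i j := fun i j => by rw [hBA]
  have h00 := hent 0 0
  have h01 := hent 0 1
  have h02 := hent 0 2
  have h10 := hent 1 0
  have h11 := hent 1 1
  have h12 := hent 1 2
  have h20 := hent 2 0
  have h21 := hent 2 1
  have h22 := hent 2 2
  simp [A, B, Matrix.mul_apply, Fin.sum_univ_three] at h00 h01 h02 h10 h11 h12 h20 h21 h22
  simp only [lor] at *
  ext i
  fin_cases i <;> simp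
  · linear_combination (-u 0) * h00 - u 1 * h10 - u 2 * h20 + z.1 0 * hu
  · linear_combination (-u 0) * h01 - u 1 * h11 - u 2 * h21 + z.1 1 * hu
  · linear_combination (-u 0) * h02 - u 1 * h12 - u 2 * h22 + z.1 2 * hu

theorem normal_perp {z z' : H2} {e n : Fin 3 → ℝ} (he : PointsTowards z e z')
    (hn : lor n z.1 = 0) (hn' : lor n z'.1 = 0) : lor n e = 0 := by
  obtain ⟨-, t, ht, h⟩ := he
  rw [h] at hn'
  have : Real.sinh t * lor n e = 0 := by
    simp only [lor, geod, Pi.add_apply, Pi.smul_apply, smul_eq_mul] at *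
    linear_combination hn' - Real.cosh t * hn
  exact (mul_eq_zero.1 this).resolve_left (by simpa using ht.ne')

theorem lor_self_expand {z : H2} {e n u : Fin 3 → ℝ} (he : IsUnitTangent z e)
    (hn : IsUnitTangent z n) (hen : lor n e = 0) (hu : IsUnitTangent z u) :
    lor u e ^ 2 + lor u n ^ 2 = 1 := by
  have h := tangent_expand he hn hen hu.1
  have h2 := hu.2
  have h0 := congrFun h 0
  have h1 := congrFun h 1
  have h3 := congrFun h 2
  simp only [Pi.add_apply, Pi.smul_apply, smul_eq_mul] at h0 h1 h3
  set c := lor u e with hc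
  set b := lor u n with hb
  simp only [lor] at hc hb h2
  linear_combination (-1) * h2 + u 0 * h0 - u 1 * h1 - u 2 * h3 + c * hc + b * hb

theorem oppositeLine_unique {z z' : H2} {ℓ ℓ₁ ℓ₂ : Set H2}
    (h₁ : EqualAlternatingAngles z ℓ z' ℓ₁) (h₂ : EqualAlternatingAngles z ℓ z' ℓ₂) :
    ℓ₁ = ℓ₂ := by
  obtain ⟨e, e', n, u, u', he, he', hn, hn', hu, hl, hu', hl', hneg, hang⟩ := h₁
  obtain ⟨f, f', m, v, v', hf, hf', hm, hm', hv, hk, hv', hk', hneg2, hang2⟩ := h₂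
  obtain rfl := pointsTowards_unique he hf
  obtain rfl := pointsTowards_unique he' hf'
  have hne := normal_perp he hn.1 hn'.1
  have hne' := normal_perp he' hn'.1 hn.1
  have hme := normal_perp he hm.1 hm'.1
  have hmn : m = -(lor m n) • n := by
    have := tangent_expand he.1 hn hne hm.1
    simpa [hme] using this
  have hneg3 : lor v n * lor v' n < 0 := by
    have a1 : lor v m = -(lor m n) * lor v n := by
      conv_lhs => rw [hmn]
      simp only [lor, Pi.smul_apply, smul_eq_mul]; ring
    have a2 : lor v' m = -(lor m n) * lor v' n := by
      conv_lhs => rw [hmn]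
      simp only [lor, Pi.smul_apply, smul_eq_mul]; ring
    rw [a1, a2] at hneg2
    by_contra hcon
    nlinarith [mul_nonneg (sq_nonneg (lor m n)) (not_lt.1 hcon)]
  have su := lor_self_expand he.1 hn hne hu
  have su' := lor_self_expand he'.1 hn' hne' hu'
  have sv := lor_self_expand he.1 hn hne hv
  have sv' := lor_self_expand he'.1 hn' hne' hv'
  have c1 : lor u e = lor u' e' := by
    have := Real.arccos_injOn (Set.mem_Icc.2 ⟨by nlinarith, by nlinarith⟩)
      (Set.mem_Icc.2 ⟨by nlinarith, by nlinarith⟩) hang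
    linarith
  have c2 : lor v e = lor v' e' := by
    have := Real.arccos_injOn (Set.mem_Icc.2 ⟨by nlinarith, by nlinarith⟩)
      (Set.mem_Icc.2 ⟨by nlinarith, by nlinarith⟩) hang2
    linarith
  have ex1 := tangent_expand he'.1 hn' hne' hu'.1
  have ex2 := tangent_expand he'.1 hn' hne' hv'.1
  rw [hl', hk']
  rcases geodLine_dir hu hv (hl.symm.trans hk) with rfl | rfl
  · have hb : lor v' n = lor u' n := by
      have h2 : (lor v' n) ^ 2 = (lor u' n) ^ 2 := by rw [← c1] at su'; rw [← c2] at sv'; linarith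
      rcases sq_eq_sq_iff_eq_or_eq_neg.1 h2 with h | h
      · exact h
      · rw [h] at hneg3; linarith
    have : v' = u' := by rw [ex2, ex1, hb, ← c1, ← c2]
    rw [this]
  · have g1 : ∀ w, lor (-u) w = -lor u w := fun w => by simp only [lor, Pi.neg_apply]; ring
    rw [g1] at c2 hneg3
    have hb : lor v' n = -lor u' n := by
      have h2 : (lor v' n) ^ 2 = (lor u' n) ^ 2 := by
        rw [← c1] at su'; rw [← c2] at sv'; linarith [neg_sq (lor u e)]
      rcases sq_eq_sq_iff_eq_or_eq_neg.1 h2 with h | h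
      · rw [h] at hneg3; linarith
      · exact h
    have : v' = -u' := by
      rw [ex2, ex1, hb, ← c1, ← c2]
      simp only [neg_neg, neg_add, neg_smul]
    rw [this, geodLine_neg]

/-- The width is the distance of `ℓ` and any supporting line that witnesses the opposition. -/
theorem jcjlWidth_eq {K : Set H2} {z z' : H2} {ℓ ℓ' : Set H2} (h : IsOppositePoint K z ℓ z')
    (h' : IsOppositeLine K z ℓ z' ℓ') : jcjlWidth K z ℓ z' h = setDist ℓ ℓ' := by
  rw [jcjlWidth, oppositeLine_unique h.2.choose_spec.2 h'.2]

end HypPlane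

namespace HypPlane

open Filter Topology


/-! ### Lorentzian linear algebra -/

/-! Write `B` for `lor`. Let `v` be an outer normal at `z`, `σ` the half-turn about the midpoint of
`[z, z']` and `N = σ v` (`altNormal`). Then `z'` is opposite to `z` exactly when `N` is an outer
normal at `z'` and `b = B(z', v) > 0` (`normal_of_equalAlternatingAngles`,
`equalAlternatingAngles_altNormal`). With `C = cosh d(z, z')`, the distance of the two lines has
hyperbolic cosine at most `B(v, N) = 1 + b² / (1 + C)`.

If all widths equal `D`: every `(z, v)` has an opposite point `z'`, found by maximising `b / (1 +
C)` over `K` (`exists_opposite`). The lines are at distance `D`, so `d(z, z') ≥ D`, hence `C = cosh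
D`. Now `cosh D ≤ 1 + b² / (1 + C)` reads `b² ≥ sinh² D`, which forces `z'` onto the perpendicular
to the supporting line at `z`. So `[z, z']` is the required normal chord.

If `K` has constant width `w`: no distance in `K` exceeds `w` (`IsOfConstantWidth.hdist_le`), so `w
= D`. For opposite `z, z'` let `y, y'` be the ends of their normal chords. Since `σ` exchanges `z,
z'` and `y, y'`, one has `(B(y, y') + 1)(B(z, z') + 1) = (B(y, z') + cosh w)²`. The left side is at
most `(1 + cosh w)²`, so `B(y, z') ≤ 1` and `y = z'`. Thus `[z, z']` is a common perpendicular of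
length `w`, and realises the distance of the lines. -/

theorem lor_comm (x y : Fin 3 → ℝ) : lor x y = lor y x := by simp only [lor]; ring

theorem lor_add_left (x y z : Fin 3 → ℝ) : lor (x + y) z = lor x z + lor y z := by
  simp only [lor, Pi.add_apply]; ring

theorem lor_add_right (x y z : Fin 3 → ℝ) : lor x (y + z) = lor x y + lor x z := by
  simp only [lor, Pi.add_apply]; ring

theorem lor_sub_left (x y z : Fin 3 → ℝ) : lor (x - y) z = lor x z - lor y z := by
  simp only [lor, Pi.sub_apply]; ring

theorem lor_sub_right (x y z : Fin 3 → ℝ) : lor x (y - z) = lor x y - lor x z := by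
  simp only [lor, Pi.sub_apply]; ring

theorem lor_neg_left (x y : Fin 3 → ℝ) : lor (-x) y = -lor x y := by
  simp only [lor, Pi.neg_apply]; ring

theorem lor_neg_right (x y : Fin 3 → ℝ) : lor x (-y) = -lor x y := by
  simp only [lor, Pi.neg_apply]; ring

theorem lor_smul_left (a : ℝ) (x y : Fin 3 → ℝ) : lor (a • x) y = a * lor x y := by
  simp only [lor, Pi.smul_apply, smul_eq_mul]; ring

theorem lor_smul_right (a : ℝ) (x y : Fin 3 → ℝ) : lor x (a • y) = a * lor x y := by
  simp only [lor, Pi.smul_apply, smul_eq_mul]; ring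

theorem continuous_lor {X : Type*} [TopologicalSpace X] {f g : X → Fin 3 → ℝ}
    (hf : Continuous f) (hg : Continuous g) : Continuous fun x => lor (f x) (g x) := by
  unfold lor; fun_prop

/-- Eliminating `w 0` by orthogonality leaves a sum of squares, which makes `-lor` positive definite
on tangent planes. -/
theorem lor_self_tangent (z : H2) {w : Fin 3 → ℝ} (hw : lor w z.1 = 0) :
    z.1 0 ^ 2 * (-lor w w) = w 1 ^ 2 + w 2 ^ 2 + (w 1 * z.1 2 - w 2 * z.1 1) ^ 2 := by
  have hz := z.2.1
  simp only [lor] at *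
  linear_combination (-w 0 * z.1 0 - w 1 * z.1 1 - w 2 * z.1 2) * hw +
    (w 1 ^ 2 + w 2 ^ 2) * hz

theorem lor_self_nonpos_of_tangent (z : H2) {w : Fin 3 → ℝ} (hw : lor w z.1 = 0) :
    lor w w ≤ 0 := by
  have h := lor_self_tangent z hw
  have hz := z.2.2
  by_contra! hc
  have : 0 < z.1 0 ^ 2 * lor w w := by positivity
  nlinarith [sq_nonneg (w 1), sq_nonneg (w 2), sq_nonneg (w 1 * z.1 2 - w 2 * z.1 1)]

theorem eq_zero_of_tangent_of_null (z : H2) {w : Fin 3 → ℝ} (hw : lor w z.1 = 0)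
    (h0 : lor w w = 0) : w = 0 := by
  have h := lor_self_tangent z hw
  have hz := z.2.2
  rw [h0] at h
  have h1 : w 1 = 0 := by
    nlinarith [sq_nonneg (w 1), sq_nonneg (w 2), sq_nonneg (w 1 * z.1 2 - w 2 * z.1 1)]
  have h2 : w 2 = 0 := by
    nlinarith [sq_nonneg (w 1), sq_nonneg (w 2), sq_nonneg (w 1 * z.1 2 - w 2 * z.1 1)]
  have h3 : w 0 = 0 := by
    simp only [lor, h1, h2] at hw
    have : w 0 * z.1 0 = 0 := by linarith
    exact (mul_eq_zero.1 this).resolve_right (by linarith)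
  ext i; fin_cases i <;> simp [h1, h2, h3]

/-- Reversed Cauchy–Schwarz: the component of `y` tangent at `x` has nonpositive square, so `B(x,
y)² ≥ 1`; both points being on the upper sheet fixes the sign. -/
theorem one_le_lor (x y : H2) : 1 ≤ lor x.1 y.1 := by
  have hx := x.2.1
  have hy := y.2.1
  have hx0 := x.2.2
  have hy0 := y.2.2
  have h : lor (y.1 - lor x.1 y.1 • x.1) (y.1 - lor x.1 y.1 • x.1) ≤ 0 := by
    apply lor_self_nonpos_of_tangent x
    simp only [lor_sub_left, lor_smul_left, hx, lor_comm y.1 x.1]; ring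
  simp only [lor_sub_left, lor_sub_right, lor_smul_left, lor_smul_right, hx, hy,
    lor_comm y.1 x.1] at h
  have hpos : 0 < lor x.1 y.1 := by
    simp only [lor] at *
    have : (x.1 1 * y.1 1 + x.1 2 * y.1 2) ^ 2 < (x.1 0 * y.1 0) ^ 2 := by
      have e1 : (x.1 1 * y.1 1 + x.1 2 * y.1 2) ^ 2 + (x.1 1 * y.1 2 - x.1 2 * y.1 1) ^ 2
          = (x.1 0 ^ 2 - 1) * (y.1 0 ^ 2 - 1) := by
        rw [show x.1 0 ^ 2 - 1 = x.1 1 ^ 2 + x.1 2 ^ 2 by linarith,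
          show y.1 0 ^ 2 - 1 = y.1 1 ^ 2 + y.1 2 ^ 2 by linarith]
        ring
      nlinarith [sq_nonneg (x.1 1 * y.1 2 - x.1 2 * y.1 1)]
    have := abs_lt_of_sq_lt_sq this (by positivity)
    linarith [this, le_abs_self (x.1 1 * y.1 1 + x.1 2 * y.1 2)]
  nlinarith

theorem eq_of_lor_eq_one {x y : H2} (h : lor x.1 y.1 = 1) : x = y := by
  have := eq_zero_of_tangent_of_null x (w := y.1 - x.1)
    (by rw [lor_sub_left, x.2.1, lor_comm y.1, h]; ring)
    (by simp only [lor_sub_left, lor_sub_right, x.2.1, y.2.1, lor_comm y.1 x.1, h]; ring)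
  exact Subtype.ext (sub_eq_zero.1 this).symm

theorem one_lt_lor {x y : H2} (h : x ≠ y) : 1 < lor x.1 y.1 :=
  lt_of_le_of_ne (one_le_lor x y) fun h' => h (eq_of_lor_eq_one h'.symm)

theorem cosh_hdist (x y : H2) : Real.cosh (hdist x y) = lor x.1 y.1 :=
  Real.cosh_arcosh (one_le_lor x y)

theorem hdist_nonneg (x y : H2) : 0 ≤ hdist x y := Real.arcosh_nonneg (one_le_lor x y)

theorem hdist_pos {x y : H2} (h : x ≠ y) : 0 < hdist x y := Real.arcosh_pos (one_lt_lor h)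

theorem hdist_le_iff {x y : H2} {t : ℝ} (ht : 0 ≤ t) :
    hdist x y ≤ t ↔ lor x.1 y.1 ≤ Real.cosh t := by
  rw [← cosh_hdist, Real.cosh_le_cosh, abs_of_nonneg ht, abs_of_nonneg (hdist_nonneg x y)]

theorem le_hdist_iff {x y : H2} {t : ℝ} (ht : 0 ≤ t) :
    t ≤ hdist x y ↔ Real.cosh t ≤ lor x.1 y.1 := by
  rw [← cosh_hdist, Real.cosh_le_cosh, abs_of_nonneg ht, abs_of_nonneg (hdist_nonneg x y)]

theorem IsUnitTangent.neg {z : H2} {u : Fin 3 → ℝ} (h : IsUnitTangent z u) :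
    IsUnitTangent z (-u) :=
  ⟨by rw [lor_neg_left, h.1, neg_zero], by rw [lor_neg_left, lor_neg_right, h.2, neg_neg]⟩

theorem exists_isUnitTangent (z : H2) : ∃ u, IsUnitTangent z u := by
  have hz := z.2.1
  have hz0 := z.2.2
  have h1 : (1 + z.1 0) ≠ 0 := by linarith
  -- The image of the first spatial basis vector under the boost taking `(1, 0, 0)` to `z`.
  refine ⟨![z.1 1, 1 + z.1 1 ^ 2 / (1 + z.1 0), z.1 1 * z.1 2 / (1 + z.1 0)], ?_, ?_⟩
  · simp only [lor, Matrix.cons_val] at *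
    field_simp
    linear_combination z.1 1 * hz
  · simp only [lor, Matrix.cons_val] at *
    field_simp
    linear_combination z.1 1 ^ 2 * hz

/-- The unit tangent vector at `x` that points towards `y ≠ x`. -/
theorem exists_direction {x y : H2} (h : x ≠ y) :
    ∃ e, IsUnitTangent x e ∧ y.1 = geod x e (hdist x y) := by
  have hs : 0 < Real.sinh (hdist x y) := Real.sinh_pos_iff.2 (hdist_pos h)
  have hc := cosh_hdist x y
  have hq := Real.cosh_sq (hdist x y)
  refine ⟨(Real.sinh (hdist x y))⁻¹ • (y.1 - lor x.1 y.1 • x.1), ⟨?_, ?_⟩, ?_⟩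
  · simp only [lor_smul_left, lor_sub_left, x.2.1, lor_comm y.1 x.1]; ring
  · simp only [lor_smul_left, lor_smul_right, lor_sub_left, lor_sub_right, x.2.1, y.2.1,
      lor_comm y.1 x.1]
    rw [← hc]
    field_simp
    linear_combination -hq
  · rw [geod, smul_inv_smul₀ hs.ne', hc]; abel

/-- The endpoint of a geodesic arc as a point of the hyperbolic plane. -/
noncomputable def geodPt (z : H2) (u : Fin 3 → ℝ) (hu : IsUnitTangent z u) (t : ℝ) : H2 :=
  ⟨geod z u t, geod_mem z u hu t⟩

/-- Unit tangent vectors with scalar product `-1` are antipodal. -/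
theorem eq_neg_of_lor_eq_one {z : H2} {u v : Fin 3 → ℝ} (hu : IsUnitTangent z u)
    (hv : IsUnitTangent z v) (h : lor u v = 1) : u = -v := by
  have := eq_zero_of_tangent_of_null z (w := u + v) (by rw [lor_add_left, hu.1, hv.1, add_zero])
    (by simp only [lor_add_left, lor_add_right, hu.2, hv.2, lor_comm v u, h]; ring)
  exact eq_neg_of_add_eq_zero_left this

theorem lor_sq_le_one {z : H2} {u v : Fin 3 → ℝ} (hu : IsUnitTangent z u)
    (hv : IsUnitTangent z v) : lor u v ^ 2 ≤ 1 := by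
  have := lor_self_nonpos_of_tangent z (w := u + lor u v • v)
    (by rw [lor_add_left, lor_smul_left, hu.1, hv.1]; ring)
  simp only [lor_add_left, lor_add_right, lor_smul_left, lor_smul_right, hu.2, hv.2,
    lor_comm v u] at this
  nlinarith

/-- A point at distance `D` from `z` whose distance to the line through `z` with normal `v` is at
least `D` is the endpoint of the perpendicular to the line. -/
theorem eq_geod_neg_of_height {z z' : H2} {v : Fin 3 → ℝ} {D : ℝ} (hv : IsUnitTangent z v)
    (hD : 0 < D) (hC : lor z.1 z'.1 = Real.cosh D) (hb : 0 ≤ lor z'.1 v)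
    (h : Real.sinh D ^ 2 ≤ lor z'.1 v ^ 2) : z'.1 = geod z (-v) D := by
  have hs : 0 < Real.sinh D := Real.sinh_pos_iff.2 hD
  have hne : z ≠ z' := by
    rintro rfl
    rw [z.2.1] at hC
    have := Real.cosh_sq D
    nlinarith
  obtain ⟨e, he, hz'⟩ := exists_direction hne
  have hd : hdist z z' = D := by rw [hdist, hC, Real.arcosh_cosh hD.le]
  rw [hd] at hz'
  have hbe : lor z'.1 v = Real.sinh D * lor e v := by
    rw [hz', geod, lor_add_left, lor_smul_left, lor_smul_left, lor_comm z.1, hv.1]; ring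
  have h1 := lor_sq_le_one he hv
  rw [hbe] at h hb
  have h2 : 0 ≤ lor e v := nonneg_of_mul_nonneg_right hb hs
  have h3 : 1 ≤ lor e v ^ 2 := by
    rw [mul_pow] at h
    exact le_of_mul_le_mul_left (by linarith) (by positivity : 0 < Real.sinh D ^ 2)
  rw [hz', eq_neg_of_lor_eq_one he hv (by nlinarith)]

/-- Nonnegative combinations of two points lie on the segment. -/
theorem mem_seg_of_eq_add {x y p : H2} {a b : ℝ} (hxy : x ≠ y) (ha : 0 ≤ a) (hb : 0 ≤ b)
    (hp : p.1 = a • x.1 + b • y.1) : p ∈ seg x y := by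
  obtain ⟨e, he, hy⟩ := exists_direction hxy
  set t := hdist x y
  have ht : 0 < t := hdist_pos hxy
  have hs : 0 < Real.sinh t := Real.sinh_pos_iff.2 ht
  have hC : lor x.1 y.1 = Real.cosh t := (cosh_hdist x y).symm
  have hn : a ^ 2 + b ^ 2 + 2 * a * b * Real.cosh t = 1 := by
    have := p.2.1
    rw [hp] at this
    simp only [lor_add_left, lor_add_right, lor_smul_left, lor_smul_right, x.2.1, y.2.1,
      lor_comm y.1 x.1, hC] at this
    linarith
  have hch := Real.one_le_cosh t
  have hb1 : b ≤ 1 := by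
    have : 0 ≤ a * b * Real.cosh t := by positivity
    nlinarith [sq_nonneg a]
  -- The coefficient of `e` in `p` is `b * sinh t`, which must be the `sinh` of the parameter; `hn`
  -- makes `a + b * cosh t` its `cosh`.
  refine ⟨e, Real.arsinh (b * Real.sinh t), t, he, ?_, ?_, hy, ?_⟩
  · exact Real.arsinh_nonneg_iff.2 (by positivity)
  · refine (Real.arsinh_le_arsinh.2 ?_).trans_eq (Real.arsinh_sinh t)
    nlinarith
  · rw [hp, hy, geod, geod, Real.sinh_arsinh, Real.cosh_arsinh]
    have : Real.sqrt (1 + (b * Real.sinh t) ^ 2) = a + b * Real.cosh t := by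
      rw [Real.sqrt_eq_iff_mul_self_eq (by positivity) (by positivity)]
      have := Real.cosh_sq t
      linear_combination -hn - b ^ 2 * this
    rw [this]; module

theorem mem_of_eq_add {K : Set H2} (hK : IsConvexBody K) {x y p : H2} {a b : ℝ} (hx : x ∈ K)
    (hy : y ∈ K) (ha : 0 ≤ a) (hb : 0 ≤ b) (hp : p.1 = a • x.1 + b • y.1) : p ∈ K := by
  by_cases hxy : x = y
  · subst hxy
    have h1 := p.2.1
    have h2 := p.2.2
    rw [← add_smul] at hp
    rw [hp, lor_smul_left, lor_smul_right, x.2.1] at h1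
    have : a + b = 1 := by nlinarith
    rw [this, one_smul] at hp
    rwa [Subtype.ext hp]
  · exact hK.2.1 x hx y hy (mem_seg_of_eq_add hxy ha hb hp)


/-! ### Half-turns of normals and the existence of opposite points -/

/-- The image of the normal `v` at `z` under the half-turn about the midpoint of `[z, z']`. -/
noncomputable def altNormal (z z' : H2) (v : Fin 3 → ℝ) : Fin 3 → ℝ :=
  (lor z'.1 v / (1 + lor z.1 z'.1)) • (z.1 + z'.1) - v

theorem isUnitTangent_altNormal (z z' : H2) {v : Fin 3 → ℝ} (hv : IsUnitTangent z v) :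
    IsUnitTangent z' (altNormal z z' v) := by
  have hC : (1 + lor z.1 z'.1) ≠ 0 := by linarith [one_le_lor z z']
  constructor
  · simp only [altNormal, lor_sub_left, lor_smul_left, lor_add_left, z'.2.1, lor_comm v]
    field_simp
    ring
  · simp only [altNormal, lor_sub_left, lor_smul_left, lor_add_left, lor_sub_right, lor_smul_right,
      lor_add_right, z.2.1, z'.2.1, lor_comm z'.1 z.1, hv.1, hv.2, lor_comm v z'.1,
      lor_comm z.1 v]
    field_simp
    ring

theorem lor_altNormal_left (z z' : H2) {v : Fin 3 → ℝ} (hv : IsUnitTangent z v) :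
    lor z.1 (altNormal z z' v) = lor z'.1 v := by
  have hC : (1 + lor z.1 z'.1) ≠ 0 := by linarith [one_le_lor z z']
  simp only [altNormal, lor_sub_right, lor_smul_right, lor_add_right, z.2.1, lor_comm z.1 v, hv.1]
  field_simp
  ring

theorem lor_altNormal_normal (z z' : H2) {v : Fin 3 → ℝ} (hv : IsUnitTangent z v) :
    lor v (altNormal z z' v) = 1 + lor z'.1 v ^ 2 / (1 + lor z.1 z'.1) := by
  simp only [altNormal, lor_sub_right, lor_smul_right, lor_add_right, hv.1, hv.2, lor_comm v z'.1]
  ring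

/-! ### Outer normals and first order conditions. -/

theorem continuous_geodPt (z : H2) (u : Fin 3 → ℝ) (hu : IsUnitTangent z u) :
    Continuous (geodPt z u hu) := by
  refine Continuous.subtype_mk ?_ _
  unfold geod
  fun_prop

/-- Moving from `z` along `v` by `t > 0` gives `B(·, v) = -sinh t < 0`, so points arbitrarily close
to `z` lie outside `K`. -/
theorem IsOuterNormal.notMem_interior {K : Set H2} {z : H2} {v : Fin 3 → ℝ}
    (hv : IsOuterNormal K z v) : z ∉ interior K := by
  intro hz
  have h0 : geodPt z v hv.1 0 = z := Subtype.ext (by simp [geodPt, geod])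
  have h1 : ∀ᶠ t in 𝓝[>] (0 : ℝ), geodPt z v hv.1 t ∈ K := by
    have : Tendsto (geodPt z v hv.1) (𝓝 0) (𝓝 z) := by
      simpa [h0] using (continuous_geodPt z v hv.1).tendsto 0
    exact (this.eventually (mem_interior_iff_mem_nhds.1 hz)).filter_mono nhdsWithin_le_nhds
  obtain ⟨t, ht, ht0⟩ := (h1.and self_mem_nhdsWithin).exists
  have h2 := hv.2 _ ht
  simp only [geodPt, geod, lor_add_left, lor_smul_left, lor_comm z.1, hv.1.1, hv.1.2] at h2
  have : 0 < Real.sinh t := Real.sinh_pos_iff.2 ht0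
  linarith

theorem IsOuterNormal.mem_frontier {K : Set H2} {z : H2} {v : Fin 3 → ℝ}
    (hv : IsOuterNormal K z v) (hz : z ∈ K) : z ∈ frontier K :=
  ⟨subset_closure hz, hv.notMem_interior⟩

theorem IsOuterNormal.exists_lor_pos {K : Set H2} (hK : IsConvexBody K) {z : H2}
    {v : Fin 3 → ℝ} (hv : IsOuterNormal K z v) : ∃ p ∈ K, 0 < lor p.1 v := by
  obtain ⟨p, hp⟩ := hK.2.2
  refine ⟨p, interior_subset hp, lt_of_le_of_ne (hv.2 p (interior_subset hp)) fun h => ?_⟩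
  exact IsOuterNormal.notMem_interior ⟨⟨by rw [lor_comm, h], hv.1.2⟩, hv.2⟩ hp

/-- First order condition for a maximiser `z` of the linear function `B(·, g)` on a convex body. -/
theorem lor_le_of_forall_le {K : Set H2} (hK : IsConvexBody K) {z : H2} (hz : z ∈ K)
    {g : Fin 3 → ℝ} (hg : ∀ p ∈ K, lor p.1 g ≤ lor z.1 g) {x : H2} (hx : x ∈ K) :
    lor x.1 g ≤ lor z.1 g * lor x.1 z.1 := by
  by_cases hne : z = x
  · subst hne; rw [z.2.1, mul_one]
  obtain ⟨e, he, hxe⟩ := exists_direction hne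
  set T := hdist z x
  have hT : 0 < T := hdist_pos hne
  have hs : 0 < Real.sinh T := Real.sinh_pos_iff.2 hT
  have hval : ∀ t, lor (geod z e t) g = Real.cosh t * lor z.1 g + Real.sinh t * lor e g := by
    intro t; rw [geod, lor_add_left, lor_smul_left, lor_smul_left]
  -- `lor e g` is the derivative at `0` of `B(·, g)` along the chord from `z` to `x`; the chord
  -- stays in `K`, so `0` is a one-sided maximum.
  have hle : lor e g ≤ 0 := by
    have hd : HasDerivAt (fun t => lor (geod z e t) g) (lor e g) 0 := by
      have := ((Real.hasDerivAt_cosh 0).mul_const (lor z.1 g)).add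
        ((Real.hasDerivAt_sinh 0).mul_const (lor e g))
      simp only [Real.sinh_zero, Real.cosh_zero, zero_mul, one_mul, zero_add] at this
      exact this.congr_of_eventuallyEq (Filter.Eventually.of_forall fun t => hval t)
    have hd' := hd.hasDerivWithinAt (s := Set.Ici 0)
    have hmax : IsLocalMaxOn (fun t => lor (geod z e t) g) (Set.Ici 0) 0 := by
      have : Set.Icc (0 : ℝ) T ∈ 𝓝[≥] (0 : ℝ) := Icc_mem_nhdsGE hT
      filter_upwards [this] with t ht
      have h0 : geod z e 0 = z.1 := by simp [geod]
      rw [h0]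
      exact hg (geodPt z e he t) (hK.2.1 z hz x hx ⟨e, t, T, he, ht.1, ht.2, hxe, rfl⟩)
    have := hmax.hasFDerivWithinAt_nonpos hd'.hasFDerivWithinAt (y := 1) (by
      apply mem_posTangentConeAt_of_segment_subset
      rw [segment_eq_Icc (by norm_num)]
      intro t ht
      exact ht.1)
    simpa using this
  rw [hxe, hval, ← hxe, lor_comm x.1, ← cosh_hdist]
  change _ ≤ lor z.1 g * Real.cosh T
  nlinarith

/-- For every outer normal there is an opposite point: the highest point of `K` over the supporting
line in the Poincaré disc centred at `z`. -/
theorem exists_opposite {K : Set H2} (hK : IsConvexBody K) {z : H2} {v : Fin 3 → ℝ}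
    (hv : IsOuterNormal K z v) :
    ∃ z' ∈ K, 0 < lor z'.1 v ∧ IsOuterNormal K z' (altNormal z z' v) := by
  obtain ⟨p, hp, hpos⟩ := hv.exists_lor_pos hK
  have hC : ∀ x : H2, 0 < 1 + lor z.1 x.1 := fun x => by linarith [one_le_lor z x]
  have hcont : ContinuousOn (fun x : H2 => lor x.1 v / (1 + lor z.1 x.1)) K :=
    (((continuous_lor continuous_subtype_val continuous_const).div
      (continuous_const.add (continuous_lor continuous_const continuous_subtype_val))
      fun x => (hC x).ne')).continuousOn
  obtain ⟨z', hz', hmax⟩ := hK.1.exists_isMaxOn ⟨p, hp⟩ hcont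
  set M := lor z'.1 v / (1 + lor z.1 z'.1) with hM
  have hM0 : 0 < M := lt_of_lt_of_le (div_pos hpos (hC p)) (hmax hp)
  refine ⟨z', hz', ?_, isUnitTangent_altNormal z z' hv.1, fun x hx => ?_⟩
  · have := mul_pos hM0 (hC z')
    rwa [hM, div_mul_cancel₀ _ (hC z').ne'] at this
  -- Maximality of the quotient means that the linear function `B(·, v - M z)` is at most `M` on
  -- `K`, with equality at `z'`. Its first order condition `B(x, v - M z) ≤ M B(x, z')` is exactly
  -- `0 ≤ B(x, N)`.
  have hval : ∀ x : H2, lor x.1 (v - M • z.1) = lor x.1 v - M * lor z.1 x.1 := fun x => by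
    rw [lor_sub_right, lor_smul_right, lor_comm x.1 z.1]
  have hz'M : lor z'.1 (v - M • z.1) = M := by
    rw [hval]
    have : M * (1 + lor z.1 z'.1) = lor z'.1 v := by rw [hM, div_mul_cancel₀ _ (hC z').ne']
    linarith
  have := lor_le_of_forall_le hK hz' (g := v - M • z.1) (fun q hq => by
    rw [hz'M, hval]
    have h1 : lor q.1 v / (1 + lor z.1 q.1) ≤ M := hmax hq
    rw [div_le_iff₀ (hC q)] at h1
    linarith) hx
  rw [hz'M, hval] at this
  rw [altNormal, ← hM]
  simp only [lor_sub_right, lor_smul_right, lor_add_right, lor_comm x.1 z.1]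
  linarith

/-! ### Interior points -/

/-- The point of the hyperboloid with given spatial coordinates. -/
noncomputable def ofSpatial (a b : ℝ) : H2 :=
  ⟨![Real.sqrt (1 + a ^ 2 + b ^ 2), a, b], by
    have : Real.sqrt (1 + a ^ 2 + b ^ 2) ^ 2 = 1 + a ^ 2 + b ^ 2 := Real.sq_sqrt (by positivity)
    simp only [lor, Matrix.cons_val]
    linarith, by
    simp only [Matrix.cons_val]
    rw [Real.one_le_sqrt]
    nlinarith [sq_nonneg a, sq_nonneg b]⟩

theorem continuous_ofSpatial : Continuous fun p : ℝ × ℝ => ofSpatial p.1 p.2 := by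
  refine Continuous.subtype_mk (continuous_pi fun i => ?_) _
  fin_cases i <;> simp <;> fun_prop

theorem eq_ofSpatial {y : Fin 3 → ℝ} (h : lor y y = 1) (h0 : 0 ≤ y 0) :
    (ofSpatial (y 1) (y 2)).1 = y := by
  have : Real.sqrt (1 + y 1 ^ 2 + y 2 ^ 2) = y 0 := by
    rw [Real.sqrt_eq_iff_mul_self_eq (by positivity) h0]
    simp only [lor] at h
    linarith
  ext i; fin_cases i <;> simp [ofSpatial, this]

/-- For `q` near `p`, solve `q = a x' + b y` for `x'` and rescale to the hyperboloid. The resulting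
`g q` depends continuously on `q` with `g p = x`, so it stays in `K`, and `q` is a nonnegative
combination of `g q` and `y`. -/
theorem mem_interior_of_eq_add {K : Set H2} (hK : IsConvexBody K) {x y p : H2} {a b : ℝ}
    (hx : x ∈ interior K) (hy : y ∈ K) (ha : 0 < a) (hb : 0 ≤ b)
    (hp : p.1 = a • x.1 + b • y.1) : p ∈ interior K := by
  rw [mem_interior_iff_mem_nhds]
  let φ : H2 → Fin 3 → ℝ := fun q => a⁻¹ • (q.1 - b • y.1)
  have hφ : Continuous φ := by fun_prop
  have hφp : φ p = x.1 := by
    simp only [φ, hp, add_sub_cancel_right]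
    rw [inv_smul_smul₀ ha.ne']
  let s : H2 → ℝ := fun q => Real.sqrt (lor (φ q) (φ q))
  have hs : Continuous s := Real.continuous_sqrt.comp (continuous_lor hφ hφ)
  have hsp : s p = 1 := by simp only [s, hφp, x.2.1, Real.sqrt_one]
  let g : H2 → H2 := fun q => ofSpatial (φ q 1 / s q) (φ q 2 / s q)
  have hgp : g p = x := by
    apply Subtype.ext
    simp only [g, hφp, hsp, div_one]
    exact eq_ofSpatial x.2.1 (by linarith [x.2.2])
  have hg : ContinuousAt g p := by
    have hne : s p ≠ 0 := by rw [hsp]; exact one_ne_zero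
    refine continuous_ofSpatial.continuousAt.comp (f := fun q => (φ q 1 / s q, φ q 2 / s q)) ?_
    exact (((continuous_apply 1).comp hφ).continuousAt.div hs.continuousAt hne).prodMk
      (((continuous_apply 2).comp hφ).continuousAt.div hs.continuousAt hne)
  have e1 : ∀ᶠ q in 𝓝 p, g q ∈ K :=
    hg.eventually (by rw [hgp]; exact mem_interior_iff_mem_nhds.1 hx)
  have e2 : ∀ᶠ q in 𝓝 p, 0 < s q :=
    hs.continuousAt.eventually (lt_mem_nhds (by rw [hsp]; exact one_pos))
  have e3 : ∀ᶠ q in 𝓝 p, 0 < φ q 0 :=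
    ((continuous_apply 0).comp hφ).continuousAt.eventually
      (lt_mem_nhds (by simp only [Function.comp, hφp]; linarith [x.2.2]))
  filter_upwards [e1, e2, e3] with q h1 h2 h3
  have hsq : s q * s q = lor (φ q) (φ q) := Real.mul_self_sqrt (Real.sqrt_pos.1 h2).le
  have hgq : (g q).1 = (s q)⁻¹ • φ q := by
    have := eq_ofSpatial (y := (s q)⁻¹ • φ q)
      (by rw [lor_smul_left, lor_smul_right, ← hsq]; field_simp)
      (by simp only [Pi.smul_apply, smul_eq_mul]; positivity)
    rw [← this]
    simp only [g, Pi.smul_apply, smul_eq_mul, div_eq_inv_mul]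
  refine mem_of_eq_add hK (a := a * s q) h1 hy (by positivity) hb ?_
  rw [hgq, smul_smul, mul_assoc, mul_inv_cancel₀ h2.ne', mul_one]
  simp only [φ]
  rw [smul_inv_smul₀ ha.ne', sub_add_cancel]


/-! ### Distances of lines -/

theorem bddBelow_setDist (A B : Set H2) :
    BddBelow {r | ∃ p ∈ A, ∃ q ∈ B, r = hdist p q} :=
  ⟨0, by rintro r ⟨p, -, q, -, rfl⟩; exact hdist_nonneg p q⟩

theorem setDist_le_hdist {A B : Set H2} {p q : H2} (hp : p ∈ A) (hq : q ∈ B) :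
    setDist A B ≤ hdist p q :=
  csInf_le (bddBelow_setDist A B) ⟨p, hp, q, hq, rfl⟩

theorem setDist_nonneg (A B : Set H2) : 0 ≤ setDist A B :=
  Real.sInf_nonneg (by rintro r ⟨p, -, q, -, rfl⟩; exact hdist_nonneg p q)

/-- On the lower sheet, `-w` would be a point of the plane with `B(-w, z) ≥ 1`. -/
theorem one_le_of_lor_pos {w : Fin 3 → ℝ} (hw : lor w w = 1) (z : H2) (h : 0 < lor w z.1) :
    1 ≤ w 0 := by
  have h1 : 1 ≤ w 0 ^ 2 := by
    simp only [lor] at hw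
    nlinarith [sq_nonneg (w 1), sq_nonneg (w 2)]
  by_contra! hlt
  have h2 : 1 ≤ (-w) 0 := by
    simp only [Pi.neg_apply]
    by_contra! h3
    nlinarith
  have := one_le_lor ⟨-w, by rw [lor_neg_left, lor_neg_right, neg_neg, hw], h2⟩ z
  rw [lor_neg_left] at this
  linarith

/-- The feet of the common perpendicular bound the distance of two lines that are exchanged by a
half-turn. -/
theorem cosh_setDist_altNormal_le (z z' : H2) {v : Fin 3 → ℝ} (hv : IsUnitTangent z v) :
    Real.cosh (setDist {x : H2 | lor x.1 v = 0} {x : H2 | lor x.1 (altNormal z z' v) = 0}) ≤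
      1 + lor z'.1 v ^ 2 / (1 + lor z.1 z'.1) := by
  have hN := isUnitTangent_altNormal z z' hv
  have hzN := lor_altNormal_left z z' hv
  have hvN := lor_altNormal_normal z z' hv
  set N := altNormal z z' v
  set b := lor z'.1 v with hb
  set C := lor z.1 z'.1 with hC
  have hC1 : 1 ≤ C := one_le_lor z z'
  have hzv : lor z.1 v = 0 := by rw [lor_comm, hv.1]
  have hz'N : lor z'.1 N = 0 := by rw [lor_comm, hN.1]
  -- The feet are the projections of the midpoint to the two lines: `z + z' + b v` and `z + z' + b
  -- N` are orthogonal to `v` and `N`, and `R` normalises both.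
  have hR2 : 0 < 2 * (1 + C) + b ^ 2 := by positivity
  set R := Real.sqrt (2 * (1 + C) + b ^ 2)
  have hR : 0 < R := Real.sqrt_pos.2 hR2
  have hRR : R ^ 2 = 2 * (1 + C) + b ^ 2 := Real.sq_sqrt hR2.le
  have hRi : R⁻¹ ^ 2 * (2 * (1 + C) + b ^ 2) = 1 := by rw [← hRR]; field_simp
  have hp1 : lor (R⁻¹ • (z.1 + z'.1 + b • v)) (R⁻¹ • (z.1 + z'.1 + b • v)) = 1 := by
    simp only [lor_smul_left, lor_smul_right, lor_add_left, lor_add_right, z.2.1, z'.2.1, hv.1,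
      hv.2, hzv, lor_comm z'.1 z.1, lor_comm v z'.1, ← hb, ← hC]
    linear_combination hRi
  have hq1 : lor (R⁻¹ • (z.1 + z'.1 + b • N)) (R⁻¹ • (z.1 + z'.1 + b • N)) = 1 := by
    simp only [lor_smul_left, lor_smul_right, lor_add_left, lor_add_right, z.2.1, z'.2.1, hN.1,
      hN.2, hz'N, lor_comm z'.1 z.1, lor_comm N z.1, hzN, ← hC]
    linear_combination hRi
  have hp0 := one_le_of_lor_pos hp1 z (by
    simp only [lor_smul_left, lor_add_left, z.2.1, hv.1, lor_comm z'.1 z.1, ← hC]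
    exact mul_pos (inv_pos.2 hR) (by linarith))
  have hq0 := one_le_of_lor_pos hq1 z' (by
    simp only [lor_smul_left, lor_add_left, z'.2.1, hN.1, ← hC]
    exact mul_pos (inv_pos.2 hR) (by linarith))
  have hle := setDist_le_hdist (A := {x : H2 | lor x.1 v = 0}) (B := {x : H2 | lor x.1 N = 0})
    (p := ⟨_, hp1, hp0⟩) (q := ⟨_, hq1, hq0⟩)
    (by
      simp only [Set.mem_ofPred_eq, lor_smul_left, lor_add_left, hzv, hv.2, ← hb]
      ring)
    (by
      simp only [Set.mem_ofPred_eq, lor_smul_left, lor_add_left, hzN, hz'N, hN.2]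
      ring)
  refine (Real.cosh_le_cosh.2 (abs_le_abs_of_nonneg (setDist_nonneg _ _) hle)).trans (le_of_eq ?_)
  rw [cosh_hdist]
  simp only [lor_smul_left, lor_smul_right, lor_add_left, lor_add_right, z.2.1, z'.2.1, hv.1,
    hzN, hz'N, hvN, lor_comm z'.1 z.1, lor_comm v z'.1, ← hb, ← hC]
  have : (1 + C) ≠ 0 := by positivity
  field_simp
  rw [hRR]
  ring

/-- Lorentzian cross product. -/
def cross (x y : Fin 3 → ℝ) : Fin 3 → ℝ :=
  ![x 1 * y 2 - x 2 * y 1, x 0 * y 2 - x 2 * y 0, x 1 * y 0 - x 0 * y 1]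

theorem lor_cross_left (x y : Fin 3 → ℝ) : lor (cross x y) x = 0 := by
  simp only [lor, cross, Matrix.cons_val]; ring

theorem lor_cross_right (x y : Fin 3 → ℝ) : lor (cross x y) y = 0 := by
  simp only [lor, cross, Matrix.cons_val]; ring

theorem lor_cross_cross (x y w : Fin 3 → ℝ) :
    lor (cross x y) (cross x w) = lor x x * lor y w - lor x w * lor y x := by
  simp only [lor, cross, Matrix.cons_val]; ring

theorem isUnitTangent_cross {z : H2} {v : Fin 3 → ℝ} (hv : IsUnitTangent z v) :
    IsUnitTangent z (cross z.1 v) :=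
  ⟨lor_cross_left _ _, by rw [lor_cross_cross, z.2.1, hv.1, hv.2]; ring⟩

/-- Coordinates along the line: the two coefficients are the `cosh` and `sinh` of the signed
distance from `z`. -/
theorem line_expand {z x : H2} {u v : Fin 3 → ℝ} (hu : IsUnitTangent z u) (hv : IsUnitTangent z v)
    (huv : lor u v = 0) (hx : lor x.1 v = 0) :
    x.1 = lor x.1 z.1 • z.1 - lor x.1 u • u ∧ lor x.1 z.1 ^ 2 - lor x.1 u ^ 2 = 1 := by
  have h1 : x.1 = lor x.1 z.1 • z.1 - lor x.1 u • u := by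
    have := tangent_expand (u := x.1 - lor x.1 z.1 • z.1) hu hv (by rw [lor_comm, huv])
      (by rw [lor_sub_left, lor_smul_left, z.2.1]; ring)
    simp only [lor_sub_left, lor_smul_left, lor_comm z.1 u, lor_comm z.1 v, hu.1, hv.1, hx] at this
    rw [sub_eq_iff_eq_add] at this
    rw [this]
    simp only [lor_add_left, lor_smul_left, z.2.1, hu.1, hv.1, hu.2, lor_comm z.1 u,
      lor_comm v u, huv]
    module
  refine ⟨h1, ?_⟩
  have h2 := x.2.1
  nth_rewrite 1 [h1] at h2
  rw [lor_sub_left, lor_smul_left, lor_smul_left, lor_comm z.1, lor_comm u] at h2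
  linarith

theorem line_eq_geodLine {z : H2} {u v : Fin 3 → ℝ} (hu : IsUnitTangent z u)
    (hv : IsUnitTangent z v) (huv : lor u v = 0) : {x : H2 | lor x.1 v = 0} = geodLine z u := by
  ext x
  constructor
  · intro hx
    obtain ⟨h1, h2⟩ := line_expand hu hv huv hx
    refine ⟨Real.arsinh (-lor x.1 u), ?_⟩
    have : Real.sqrt (1 + (-lor x.1 u) ^ 2) = lor x.1 z.1 := by
      rw [Real.sqrt_eq_iff_mul_self_eq (by positivity) (by linarith [one_le_lor x z])]
      linarith
    rw [geod, Real.sinh_arsinh, Real.cosh_arsinh, this]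
    nth_rewrite 1 [h1]
    module
  · rintro ⟨t, ht⟩
    rw [Set.mem_ofPred_eq, ht, geod, lor_add_left, lor_smul_left, lor_smul_left, huv, lor_comm z.1,
      hv.1]
    ring

theorem setDist_of_perpendicular {z z' : H2} {v : Fin 3 → ℝ} {D : ℝ} (hv : IsUnitTangent z v)
    (hD : 0 ≤ D) (hz' : z'.1 = geod z (-v) D) :
    setDist {x : H2 | lor x.1 v = 0} {x : H2 | lor x.1 (altNormal z z' v) = 0} = D := by
  have hN := isUnitTangent_altNormal z z' hv
  have hC : lor z.1 z'.1 = Real.cosh D := by rw [hz', lor_comm, lor_geod z (-v) hv.neg]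
  have hzv : lor z.1 v = 0 := by rw [lor_comm, hv.1]
  have hz : z ∈ {x : H2 | lor x.1 v = 0} := hzv
  have hz'm : z' ∈ {x : H2 | lor x.1 (altNormal z z' v) = 0} := by
    rw [Set.mem_ofPred_eq, lor_comm, hN.1]
  apply le_antisymm
  · exact (setDist_le_hdist hz hz'm).trans ((hdist_le_iff hD).2 hC.le)
  · refine le_csInf ⟨_, z, hz, z', hz'm, rfl⟩ ?_
    rintro r ⟨p, hp, q, hq, rfl⟩
    rw [le_hdist_iff hD]
    -- `u` is a direction of both lines, at `z` and at `z'`. In these coordinates `B(p, q) = P Q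
    -- cosh D - s t`, and `P Q ≥ 1 + |s t|` bounds it below by `cosh D`.
    set u := cross z.1 v with hu_def
    have hu : IsUnitTangent z u := isUnitTangent_cross hv
    have huv : lor u v = 0 := lor_cross_right _ _
    have huz' : lor u z'.1 = 0 := by
      rw [hz', geod, lor_add_right, lor_smul_right, lor_smul_right, lor_neg_right, hu.1, huv]; ring
    have huN : lor u (altNormal z z' v) = 0 := by
      rw [altNormal, lor_sub_right, lor_smul_right, lor_add_right, hu.1, huz', huv]; ring
    obtain ⟨p1, p2⟩ := line_expand hu hv huv hp
    obtain ⟨q1, q2⟩ := line_expand ⟨huz', hu.2⟩ hN huN hq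
    have hP := one_le_lor p z
    have hQ := one_le_lor q z'
    rw [p1, q1]
    simp only [lor_sub_left, lor_sub_right, lor_smul_left, lor_smul_right, hC, hu.2, huz',
      lor_comm z.1 u, hu.1]
    set P := lor p.1 z.1
    set Q := lor q.1 z'.1
    set s := lor p.1 u
    set t := lor q.1 u
    have hc := Real.one_le_cosh D
    have h1 : 1 + |s * t| ≤ P * Q := by
      apply le_of_sq_le_sq _ (by positivity)
      have : |s * t| ^ 2 = s ^ 2 * t ^ 2 := by rw [sq_abs]; ring
      have e : (P * Q) ^ 2 = (1 + s ^ 2) * (1 + t ^ 2) := by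
        rw [mul_pow]; congr 1 <;> linarith
      rw [e, abs_mul]
      nlinarith [sq_nonneg (|s| - |t|), sq_abs s, sq_abs t]
    have h2 := le_abs_self (s * t)
    nlinarith [abs_nonneg (s * t)]

/-! ### Opposite points and alternating angles -/

theorem lor_altNormal_altNormal (z z' : H2) {u v : Fin 3 → ℝ} (hu : IsUnitTangent z u)
    (hv : IsUnitTangent z v) : lor (altNormal z z' u) (altNormal z z' v) = lor u v := by
  have hC : (1 + lor z.1 z'.1) ≠ 0 := by linarith [one_le_lor z z']
  simp only [altNormal, lor_sub_left, lor_smul_left, lor_add_left, lor_sub_right, lor_smul_right,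
    lor_add_right, z.2.1, z'.2.1, lor_comm z'.1 z.1, hu.1, hv.1, lor_comm u z'.1, lor_comm z.1 v]
  field_simp
  ring

/-- The direction back from `z' = geod z e T` to `z`. -/
theorem pointsTowards_back {z z' : H2} {e : Fin 3 → ℝ} {T : ℝ} (he : IsUnitTangent z e)
    (hT : 0 < T) (hz' : z'.1 = geod z e T) :
    PointsTowards z' (-(Real.sinh T • z.1 + Real.cosh T • e)) z := by
  have hq := Real.cosh_sq T
  have hze : lor z.1 e = 0 := by rw [lor_comm, he.1]
  refine ⟨⟨?_, ?_⟩, T, hT, ?_⟩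
  · rw [hz', geod]
    simp only [lor_neg_left, lor_add_left, lor_add_right, lor_smul_left, lor_smul_right, z.2.1,
      he.1, he.2, hze]
    ring
  · simp only [lor_neg_left, lor_neg_right, lor_add_left, lor_add_right, lor_smul_left,
      lor_smul_right, z.2.1, he.1, he.2, hze]
    linarith
  · rw [geod, hz', geod]
    have : z.1 = (Real.cosh T ^ 2 - Real.sinh T ^ 2) • z.1 := by
      rw [Real.cosh_sq_sub_sinh_sq, one_smul]
    nth_rewrite 1 [this]
    module

/-- The half-turn carries the direction `e` to the direction back from `z'` to `z`, so angles with
the segment are preserved. -/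
theorem lor_altNormal_back {z z' : H2} {e u : Fin 3 → ℝ} {T : ℝ} (he : IsUnitTangent z e)
    (hz' : z'.1 = geod z e T) (hu : IsUnitTangent z u) :
    lor (altNormal z z' u) (-(Real.sinh T • z.1 + Real.cosh T • e)) = lor u e := by
  have hq := Real.cosh_sq T
  have hze : lor z.1 e = 0 := by rw [lor_comm, he.1]
  have hzu : lor z.1 u = 0 := by rw [lor_comm, hu.1]
  have hC : lor z.1 z'.1 = Real.cosh T := by rw [hz', lor_comm, lor_geod z e he]
  have hz'e : lor z'.1 e = -Real.sinh T := by
    rw [hz', geod, lor_add_left, lor_smul_left, lor_smul_left, hze, he.2]; ring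
  have hz'u : lor z'.1 u = Real.sinh T * lor u e := by
    rw [hz', geod, lor_add_left, lor_smul_left, lor_smul_left, hzu, lor_comm e]; ring
  have hc : 1 + Real.cosh T ≠ 0 := by linarith [Real.one_le_cosh T]
  simp only [altNormal, lor_neg_right, lor_add_right, lor_smul_right, lor_sub_left, lor_smul_left,
    lor_add_left, z.2.1, hze, hu.1, lor_comm z'.1 z.1, hC, hz'e, hz'u]
  field_simp
  linear_combination (lor u e * (1 + Real.cosh T)) * hq - lor u e * Real.cosh T * hq

/-- The half-turn exchanges the two sides of the line `zz'`. -/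
theorem lor_altNormal_perp {z z' : H2} {u n : Fin 3 → ℝ} (hn : lor n z.1 = 0)
    (hn' : lor n z'.1 = 0) : lor (altNormal z z' u) n = -lor u n := by
  rw [altNormal, lor_sub_left, lor_smul_left, lor_add_left, lor_comm z.1 n, lor_comm z'.1 n, hn, hn']
  ring

theorem equalAlternatingAngles_altNormal {z z' : H2} {v : Fin 3 → ℝ} (hv : IsUnitTangent z v)
    (hpos : 0 < lor z'.1 v) :
    EqualAlternatingAngles z {x : H2 | lor x.1 v = 0} z'
      {x : H2 | lor x.1 (altNormal z z' v) = 0} := by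
  have hne : z ≠ z' := by
    rintro rfl
    rw [lor_comm, hv.1] at hpos
    exact hpos.false
  obtain ⟨e, he, hz'⟩ := exists_direction hne
  have hT := hdist_pos hne
  set T := hdist z z'
  set u := cross z.1 v
  set n := cross z.1 e
  have hu : IsUnitTangent z u := isUnitTangent_cross hv
  have huv : lor u v = 0 := lor_cross_right _ _
  have hn : IsUnitTangent z n := isUnitTangent_cross he
  have hnz' : lor n z'.1 = 0 := by
    rw [hz', geod, lor_add_right, lor_smul_right, lor_smul_right, hn.1, lor_cross_right]; ring
  have hN := isUnitTangent_altNormal z z' hv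
  have hu' := isUnitTangent_altNormal z z' hu
  refine ⟨e, _, n, u, altNormal z z' u, ⟨he, T, hT, hz'⟩, pointsTowards_back he hT hz', hn,
    ⟨hnz', hn.2⟩, hu, line_eq_geodLine hu hv huv, hu', line_eq_geodLine hu' hN ?_, ?_, ?_⟩
  · rw [lor_altNormal_altNormal z z' hu hv, huv]
  · rw [lor_altNormal_perp hn.1 hnz']
    -- `cross z.1` is a quarter-turn of the tangent plane, hence an isometry.
    have hun : lor u n = lor v e := by
      rw [lor_cross_cross, z.2.1, lor_comm z.1, he.1]; ring
    have : lor v e ≠ 0 := fun h0 => by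
      rw [hz', geod, lor_add_left, lor_smul_left, lor_smul_left, lor_comm z.1, hv.1,
        lor_comm e, h0] at hpos
      simp at hpos
    rw [hun]
    have := sq_pos_of_ne_zero this
    nlinarith
  · rw [tangentAngle, tangentAngle, lor_altNormal_back he hz' hu]

theorem lor_eq_zero_of_line_eq {z : H2} {u v : Fin 3 → ℝ} (hu : IsUnitTangent z u)
    (hv : IsUnitTangent z v) (h : {x : H2 | lor x.1 v = 0} = geodLine z u) : lor u v = 0 := by
  have h1 : geodPt z u hu 1 ∈ {x : H2 | lor x.1 v = 0} := h ▸ ⟨1, rfl⟩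
  simp only [Set.mem_ofPred_eq, geodPt, geod, lor_add_left, lor_smul_left, lor_comm z.1, hv.1,
    mul_zero, zero_add, mul_eq_zero] at h1
  exact h1.resolve_left (by simp)

/-- The equal angle and the opposite sides determine both coordinates of `u'` in the frame `e', n`,
so `u'` is the half-turn image of `u`. Hence `v'` is `N` up to sign, and the sign is settled because
`z` lies on the inner side. -/
theorem normal_of_equalAlternatingAngles {K : Set H2} {z z' : H2} (hz : z ∈ K) (hz' : z' ∈ K)
    {v v' : Fin 3 → ℝ} (hv : IsOuterNormal K z v) (hv' : IsOuterNormal K z' v')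
    (h : EqualAlternatingAngles z {x : H2 | lor x.1 v = 0} z' {x : H2 | lor x.1 v' = 0}) :
    v' = altNormal z z' v ∧ 0 < lor z'.1 v := by
  obtain ⟨e, e', n, u, u', he, he', hn, hn', hu, hl, hu', hl', hneg, hang⟩ := h
  have hne := normal_perp he hn.1 hn'.1
  have hne' := normal_perp he' hn'.1 hn.1
  have huv := lor_eq_zero_of_line_eq hu hv.1 hl
  have huv' := lor_eq_zero_of_line_eq hu' hv'.1 hl'
  have su := lor_self_expand he.1 hn hne hu
  have su' := lor_self_expand he'.1 hn' hne' hu'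
  have c1 : lor u e = lor u' e' := by
    have := Real.arccos_injOn (Set.mem_Icc.2 ⟨by nlinarith, by nlinarith⟩)
      (Set.mem_Icc.2 ⟨by nlinarith, by nlinarith⟩) hang
    linarith
  have c2 : lor u' n = -lor u n := by
    have h2 : lor u' n ^ 2 = lor u n ^ 2 := by rw [← c1] at su'; linarith
    rcases sq_eq_sq_iff_eq_or_eq_neg.1 h2 with h | h
    · rw [h] at hneg; nlinarith [mul_self_nonneg (lor u n)]
    · exact h
  obtain ⟨T, hT, hz'T⟩ := he.2
  obtain rfl := pointsTowards_unique he' (pointsTowards_back he.1 hT hz'T)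
  have hN := isUnitTangent_altNormal z z' hv.1
  have hW := isUnitTangent_altNormal z z' hu
  have hu'W : u' = altNormal z z' u := by
    rw [tangent_expand he'.1 hn' hne' hu'.1, tangent_expand he'.1 hn' hne' hW.1,
      lor_altNormal_back he.1 hz'T hu, lor_altNormal_perp hn.1 hn'.1, ← c1, c2]
  have hNu' : lor (altNormal z z' v) u' = 0 := by
    rw [hu'W, lor_altNormal_altNormal z z' hv.1 hu, lor_comm, huv]
  have hb : 0 < lor z'.1 v := by
    -- If `b = 0`, the supporting line at `z` is the line `zz'`, and `u` points to neither open side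
    -- of it.
    refine lt_of_le_of_ne (hv.2 z' hz') fun h0 => ?_
    have hz'v : lor z'.1 v = Real.sinh T * lor v e := by
      rw [hz'T, geod, lor_add_left, lor_smul_left, lor_smul_left, lor_comm z.1, hv.1.1,
        lor_comm e]; ring
    have hve : lor v e = 0 := by
      rw [← h0] at hz'v
      exact (mul_eq_zero.1 hz'v.symm).resolve_left (by simpa using hT.ne')
    have := tangent_expand he.1 hv.1 hve hu.1
    rw [huv, neg_zero, zero_smul, add_zero] at this
    have hun : lor u n = 0 := by
      rw [this, lor_smul_left, lor_comm e n, hne, mul_zero]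
    rw [hun, zero_mul] at hneg
    exact hneg.false
  refine ⟨?_, hb⟩
  have hexp := tangent_expand hu' hv'.1 (by rw [lor_comm, huv']) hN.1
  rw [hNu', neg_zero, zero_smul, zero_add] at hexp
  set k := -lor (altNormal z z' v) v'
  have h1 := hN.2
  have h2 := lor_altNormal_left z z' hv.1
  rw [hexp, lor_smul_left, lor_smul_right, hv'.1.2] at h1
  rw [hexp, lor_smul_right] at h2
  have h3 := hv'.2 z hz
  have hk : 0 < k := by
    by_contra! hk
    nlinarith [mul_nonneg_of_nonpos_of_nonpos hk (neg_nonpos.2 h3)]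
  have : k = 1 := by nlinarith
  rw [hexp, this, one_smul]


/-! ### Diameter and constant width -/

theorem continuous_hdist : Continuous fun p : H2 × H2 => hdist p.1 p.2 :=
  Real.continuousOn_arcosh.comp_continuous
    (continuous_lor (by fun_prop) (by fun_prop)) fun p => one_le_lor p.1 p.2

theorem hdist_le_hdiam {K : Set H2} (hK : IsCompact K) {x y : H2} (hx : x ∈ K) (hy : y ∈ K) :
    hdist x y ≤ hdiam K := by
  refine le_csSup ?_ ⟨x, hx, y, hy, rfl⟩
  obtain ⟨M, hM⟩ := (hK.prod hK).bddAbove_image continuous_hdist.continuousOn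
  refine ⟨M, ?_⟩
  rintro r ⟨p, hp, q, hq, rfl⟩
  exact hM ⟨(p, q), ⟨hp, hq⟩, rfl⟩

theorem IsConvexBody.nonempty {K : Set H2} (hK : IsConvexBody K) : K.Nonempty :=
  hK.2.2.mono interior_subset

theorem exists_farthest {K : Set H2} (hK : IsConvexBody K) (a : H2) :
    ∃ z ∈ K, ∀ p ∈ K, lor p.1 a.1 ≤ lor z.1 a.1 :=
  hK.1.exists_isMaxOn hK.nonempty
    (continuous_lor continuous_subtype_val continuous_const).continuousOn

/-- The disc about `a` through `z` contains `K`. Algebraically, the first order condition `B(x, a) ≤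
cosh T * B(x, z)` reduces to `sinh T * B(x, e) ≤ 0`. -/
theorem isOuterNormal_of_farthest {K : Set H2} (hK : IsConvexBody K) {a z : H2} (hz : z ∈ K)
    (hmax : ∀ p ∈ K, lor p.1 a.1 ≤ lor z.1 a.1) {e : Fin 3 → ℝ} {T : ℝ} (he : IsUnitTangent z e)
    (hT : 0 < T) (ha : a.1 = geod z e T) : IsOuterNormal K z (-e) := by
  refine ⟨he.neg, fun x hx => ?_⟩
  have h := lor_le_of_forall_le hK hz hmax hx
  have hC : lor z.1 a.1 = Real.cosh T := by rw [ha, lor_comm, lor_geod z e he]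
  rw [hC, ha, geod, lor_add_right, lor_smul_right, lor_smul_right] at h
  have hs : 0 < Real.sinh T := Real.sinh_pos_iff.2 hT
  rw [lor_neg_right]
  by_contra! h'
  nlinarith

theorem exists_isOuterNormal {K : Set H2} (hK : IsConvexBody K) :
    ∃ z ∈ K, ∃ v, IsOuterNormal K z v := by
  obtain ⟨a, ha⟩ := hK.nonempty
  obtain ⟨z, hz, hmax⟩ := exists_farthest hK a
  refine ⟨z, hz, ?_⟩
  -- If the farthest point is `a` itself, `K` is a single point and every unit tangent vector
  -- qualifies.
  by_cases hne : z = a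
  · obtain ⟨v, hv⟩ := exists_isUnitTangent z
    refine ⟨v, hv, fun x hx => ?_⟩
    have h1 := hmax x hx
    rw [hne, a.2.1] at h1
    have : x = z := hne ▸ eq_of_lor_eq_one (le_antisymm h1 (one_le_lor x a))
    rw [this, lor_comm, hv.1]
  · obtain ⟨e, he, hae⟩ := exists_direction hne
    exact ⟨-e, isOuterNormal_of_farthest hK hz hmax he (hdist_pos hne) hae⟩

theorem geod_eq_combination {z a : H2} {e : Fin 3 → ℝ} {T : ℝ} (hT : 0 < T)
    (ha : a.1 = geod z e T) (t : ℝ) :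
    geod z e t = (Real.sinh t / Real.sinh T) • a.1 + (Real.sinh (T - t) / Real.sinh T) • z.1 := by
  have hs : Real.sinh T ≠ 0 := (Real.sinh_pos_iff.2 hT).ne'
  rw [ha, geod, geod, Real.sinh_sub, smul_add, smul_smul, smul_smul, div_mul_cancel₀ _ hs]
  have : Real.cosh t = Real.sinh t / Real.sinh T * Real.cosh T +
      (Real.sinh T * Real.cosh t - Real.cosh T * Real.sinh t) / Real.sinh T := by
    field_simp; ring
  nth_rewrite 1 [this]
  module

/-- Points of the geodesic from `z ∈ K` to an interior point, other than `z`, are interior. -/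
theorem geodPt_mem_interior {K : Set H2} (hK : IsConvexBody K) {z a : H2} (hz : z ∈ K)
    (ha : a ∈ interior K) {e : Fin 3 → ℝ} {T t : ℝ} (he : IsUnitTangent z e) (hT : 0 < T)
    (hae : a.1 = geod z e T) (ht : 0 < t) (htT : t ≤ T) : geodPt z e he t ∈ interior K := by
  have hs : 0 < Real.sinh T := Real.sinh_pos_iff.2 hT
  exact mem_interior_of_eq_add hK ha hz (div_pos (Real.sinh_pos_iff.2 ht) hs)
    (div_nonneg (Real.sinh_nonneg_iff.2 (sub_nonneg.2 htT)) hs.le) (geod_eq_combination hT hae t)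

theorem IsConvexBody.mem_closure_interior {K : Set H2} (hK : IsConvexBody K) {x : H2}
    (hx : x ∈ K) : x ∈ closure (interior K) := by
  obtain ⟨a, ha⟩ := hK.2.2
  by_cases hne : x = a
  · exact subset_closure (hne ▸ ha)
  obtain ⟨e, he, hae⟩ := exists_direction hne
  have hT := hdist_pos hne
  have h0 : geodPt x e he 0 = x := Subtype.ext (by simp [geodPt, geod])
  have h1 : Tendsto (geodPt x e he) (𝓝[>] 0) (𝓝 x) := by
    have := (continuous_geodPt x e he).tendsto 0
    rw [h0] at this
    exact this.mono_left nhdsWithin_le_nhds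
  refine mem_closure_of_tendsto h1 ?_
  filter_upwards [Ioc_mem_nhdsGT hT] with t ht
  exact geodPt_mem_interior hK hx ha he hT hae ht.1 ht.2

/-- If a distance exceeded `w`, one endpoint could be moved to an interior point `a`. From the point
`z` farthest from `a`, the normal chord runs towards `a` and stops at distance `w` before reaching
it, hence at an interior point, although it must end on the boundary. -/
theorem IsOfConstantWidth.hdist_le {K : Set H2} (hK : IsConvexBody K) {w : ℝ}
    (hw : IsOfConstantWidth K w) {x y : H2} (hx : x ∈ K) (hy : y ∈ K) : hdist x y ≤ w := by
  by_contra! hlt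
  have hopen : IsOpen {q : H2 | w < hdist q y} :=
    isOpen_lt continuous_const (continuous_hdist.comp (continuous_id.prodMk continuous_const))
  obtain ⟨a, haw, ha⟩ := mem_closure_iff.1 (hK.mem_closure_interior hx) _ hopen hlt
  obtain ⟨z, hz, hmax⟩ := exists_farthest hK a
  have hza : w < hdist z a := by
    have h1 := hmax y hy
    rw [← cosh_hdist, ← cosh_hdist, Real.cosh_le_cosh, abs_of_nonneg (hdist_nonneg _ _),
      abs_of_nonneg (hdist_nonneg _ _)] at h1
    have h2 : hdist a y = hdist y a := by rw [hdist, hdist, lor_comm]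
    exact lt_of_lt_of_le (h2 ▸ haw) h1
  have hne : z ≠ a := by
    rintro rfl
    rw [hdist, z.2.1, Real.arcosh_zero] at hza
    exact (hw.1.trans hza).false
  obtain ⟨e, he, hae⟩ := exists_direction hne
  have hv := isOuterNormal_of_farthest hK hz hmax he (hdist_pos hne) hae
  obtain ⟨q, hq, -, hqe⟩ := hw.2 z (hv.mem_frontier hz) _ hv
  rw [neg_neg] at hqe
  have : q = geodPt z e he w := Subtype.ext hqe
  exact hq.2 (this ▸ geodPt_mem_interior hK hz ha he (hdist_pos hne) hae hw.1 hza.le)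

theorem IsConvexBody.frontier_subset {K : Set H2} (hK : IsConvexBody K) : frontier K ⊆ K :=
  hK.1.isClosed.frontier_subset

theorem IsOfConstantWidth.hdiam_eq {K : Set H2} (hK : IsConvexBody K) {w : ℝ}
    (hw : IsOfConstantWidth K w) : hdiam K = w := by
  obtain ⟨z, hz, v, hv⟩ := exists_isOuterNormal hK
  apply le_antisymm
  · refine csSup_le ⟨_, z, hz, z, hz, rfl⟩ ?_
    rintro r ⟨x, hx, y, hy, rfl⟩
    exact hw.hdist_le hK hx hy
  · obtain ⟨y, hy, -, hye⟩ := hw.2 z (hv.mem_frontier hz) v hv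
    refine le_trans ?_ (hdist_le_hdiam hK.1 hz (hK.frontier_subset hy))
    rw [le_hdist_iff hw.1.le, hye, lor_comm, lor_geod z _ hv.1.neg]

/-- In a body of constant width, opposite points are the endpoints of a double normal. -/
theorem IsOfConstantWidth.eq_geod_of_opposite {K : Set H2} (hK : IsConvexBody K) {w : ℝ}
    (hw : IsOfConstantWidth K w) {z z' : H2} {v : Fin 3 → ℝ} (hz : z ∈ K) (hz' : z' ∈ K)
    (hv : IsOuterNormal K z v) (hv' : IsOuterNormal K z' (altNormal z z' v)) :
    z'.1 = geod z (-v) w := by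
  obtain ⟨y, hy, -, hye⟩ := hw.2 z (hv.mem_frontier hz) v hv
  obtain ⟨y', hy', -, hye'⟩ := hw.2 z' (hv'.mem_frontier hz') _ hv'
  have hyy' := (hdist_le_iff hw.1.le).1
    (hw.hdist_le hK (hK.frontier_subset hy) (hK.frontier_subset hy'))
  have hzz' := (hdist_le_iff hw.1.le).1 (hw.hdist_le hK hz hz')
  have hC1 := one_le_lor z z'
  have hzy' := one_le_lor y z'
  have hzv : lor z.1 v = 0 := by rw [lor_comm, hv.1.1]
  have hzN := lor_altNormal_left z z' hv.1
  have hvN := lor_altNormal_normal z z' hv.1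
  have hq := Real.cosh_sq w
  have hc1 := Real.one_le_cosh w
  have e1 : lor y.1 z'.1 = Real.cosh w * lor z.1 z'.1 - Real.sinh w * lor z'.1 v := by
    rw [hye, geod, lor_add_left, lor_smul_left, lor_smul_left, lor_neg_left, lor_comm v]; ring
  -- With `m` the midpoint of `[z, z']`, `B(x, σ x) + 1 = 2 B(x, m)²`, and `B(y, z') + B(y, z) = 2
  -- B(y, m) B(z, m)` where `B(y, z) = cosh w`.
  have e2 : (lor y.1 y'.1 + 1) * (1 + lor z.1 z'.1) = (lor y.1 z'.1 + Real.cosh w) ^ 2 := by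
    rw [e1, hye, hye']
    simp only [geod, lor_add_left, lor_add_right, lor_smul_left, lor_smul_right, lor_neg_left,
      lor_neg_right, hzN, hvN, lor_comm v z'.1]
    have : 1 + lor z.1 z'.1 ≠ 0 := by linarith
    field_simp
    linear_combination (-(1 + lor z.1 z'.1)) * hq
  have e3 : (lor y.1 z'.1 + Real.cosh w) ^ 2 ≤ (1 + Real.cosh w) ^ 2 := by
    rw [← e2, sq]
    exact mul_le_mul (by linarith) (by linarith) (by linarith) (by linarith)
  have e4 := le_of_sq_le_sq e3 (by linarith)
  have : y = z' := eq_of_lor_eq_one (by linarith)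
  rw [← this, hye]

/-- A convex body has constant width if and only if all its JCJL widths equal its diameter. -/
theorem hasConstantWidth_iff_forall_jcjlWidth {K : Set H2} (hK : IsConvexBody K) :
    HasConstantWidth K ↔ ∀ z ∈ frontier K, ∀ ℓ : Set H2, IsSupportingLine K z ℓ →
      ∀ (z' : H2) (h : IsOppositePoint K z ℓ z'), jcjlWidth K z ℓ z' h = hdiam K := by
  constructor
  · rintro ⟨w, hw⟩ z hz ℓ ⟨v, hv, rfl⟩ z' hopp
    obtain ⟨hz', ℓ', h⟩ := id hopp
    rw [jcjlWidth_eq hopp h, hw.hdiam_eq hK]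
    obtain ⟨⟨v', hv', rfl⟩, hang⟩ := h
    have hzK := hK.frontier_subset hz
    have hzK' := hK.frontier_subset hz'
    obtain ⟨rfl, -⟩ := normal_of_equalAlternatingAngles hzK hzK' hv hv' hang
    exact setDist_of_perpendicular hv.1 hw.1.le (hw.eq_geod_of_opposite hK hzK hzK' hv hv')
  · intro H
    have hle : ∀ {x y : H2}, x ∈ K → y ∈ K → hdist x y ≤ hdiam K :=
      fun hx hy => hdist_le_hdiam hK.1 hx hy
    have hpos : 0 < hdiam K := by
      obtain ⟨z, hz, v, hv⟩ := exists_isOuterNormal hK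
      obtain ⟨z', hz', hb, -⟩ := exists_opposite hK hv
      refine lt_of_lt_of_le (hdist_pos ?_) (hle hz hz')
      rintro rfl
      rw [lor_comm, hv.1.1] at hb
      exact hb.false
    refine ⟨hdiam K, hpos, fun z hz v hv => ?_⟩
    have hzK := hK.frontier_subset hz
    obtain ⟨z', hz', hb, hv'⟩ := exists_opposite hK hv
    have hfr := hv'.mem_frontier hz'
    refine ⟨z', hfr, hK.2.1 z hzK z' hz', ?_⟩
    have hopp : IsOppositeLine K z {x : H2 | lor x.1 v = 0} z'
        {x : H2 | lor x.1 (altNormal z z' v) = 0} :=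
      ⟨⟨_, hv', rfl⟩, equalAlternatingAngles_altNormal hv.1 hb⟩
    have hpt : IsOppositePoint K z {x : H2 | lor x.1 v = 0} z' := ⟨hfr, _, hopp⟩
    have hwidth := H z hz _ ⟨v, hv, rfl⟩ z' hpt
    rw [jcjlWidth_eq hpt hopp] at hwidth
    have hup := cosh_setDist_altNormal_le z z' hv.1
    have hlow : setDist {x : H2 | lor x.1 v = 0} {x : H2 | lor x.1 (altNormal z z' v) = 0} ≤
        hdist z z' :=
      setDist_le_hdist (p := z) (q := z') (by rw [Set.mem_ofPred_eq, lor_comm, hv.1.1])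
        (by rw [Set.mem_ofPred_eq, lor_comm, hv'.1.1])
    rw [hwidth] at hup hlow
    have hd : hdist z z' = hdiam K := le_antisymm (hle hzK hz') hlow
    have hC : lor z.1 z'.1 = Real.cosh (hdiam K) := by rw [← hd, cosh_hdist]
    refine eq_geod_neg_of_height hv.1 hpos hC hb.le ?_
    have hc := Real.one_le_cosh (hdiam K)
    have hq := Real.cosh_sq (hdiam K)
    -- `hup` becomes `(cosh D - 1)(1 + cosh D) ≤ b²`, whose left side is `sinh² D`.
    rw [hC, ← sub_le_iff_le_add', le_div_iff₀ (by linarith)] at hup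
    linarith

end HypPlane

theorem mainTheorem7 (K : Set HypPlane.H2) (hK : HypPlane.IsConvexBody K)
    (D : ℝ) (hD : HypPlane.hdiam K = D) :
    HypPlane.HasConstantWidth K ↔
      ∀ z ∈ frontier K, ∀ ℓ : Set HypPlane.H2, HypPlane.IsSupportingLine K z ℓ →
        ∀ (z' : HypPlane.H2) (h : HypPlane.IsOppositePoint K z ℓ z'),
          HypPlane.jcjlWidth K z ℓ z' h = D := by
  subst hD
  exact HypPlane.hasConstantWidth_iff_forall_jcjlWidth hK
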